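/- Let $K$ be a field, $X$ a finite set and $\Gamma$ the free group on $X$ with a total order $<$ that is compatible with its group structure (invariant under left and right multiplication). Let $A = X\cup\overline X$, where $\overline X=\{\overline x : x\in X\}$ is a disjoint copy of $X$ ($\overline x$ stands for $x^{-1}$), and identify $\Gamma$ with the set of reduced words in $A^*$ (words without a factor $x\overline x$ or $\overline x x$). A series $S=\sum_{w\in A^*}(S,w)\,w$ with coefficients in $K$ is rational if it is denoted by a well-formed rational expression, that is, one built from scalars and letters by sums, Cauchy products, and stars $p^*=1+p+p^2+\cdots$ of series $p$ without constant term. Its support is $\mathsf{supp}(S)=\{w : (S,w)\ne 0\}$. Its Hankel rank is the dimension of the span of the right translates $\sum_{w}(S,wu)\,w$, $u\in A^*$. Consider rational series $S$ over $A$ whose support consists of reduced words and is well-ordered for the order of $\Gamma$. Then $\mathsf{min}\,\mathsf{supp}(S)$ is effectively computable. Precisely: (1) There is a computable function $N:\mathbb N\times\mathbb N\to\mathbb N$ such that, for every field $K$, every finite $X$, every compatible total order on $\Gamma$, and every such $S$, of Hankel rank $n$: every word $w\in\mathsf{supp}(S)$ of length at least $N(n,|X|)$ has a subword (subsequence) $v\in\mathsf{supp}(S)$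 with $v<w$ in the group order. (2) Suppose that $K$ is a computable field (its elements are coded so that addition and multiplication are computable, equality of elements being equality of codes) and that the order is computable (given two words over $A$, it is decidable whether the element of $\Gamma$ represented by the first is smaller than that represented by the second). Then there is a total computable function which, for every well-formed rational expression denoting such a series $S$ (the expression being written as a string in postfix notation), returns the minimum of $\mathsf{supp}(S)$ as a reduced word if $\mathsf{supp}(S)\neq\emptyset$, and reports that the support is empty if $\mathsf{supp}(S)=\emptyset$. -/

import Mathlib

/-- Formal series over the free monoid on `A` with coefficients in `K`: the value at a word `w` is
the coefficient `(S, w)`.  Sums are the pointwise ones of the function type. -/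
abbrev WordSeries (A K : Type*) := List A → K

namespace WordSeries

variable {A K : Type*} [Field K]

/-- The set of words with nonzero coefficient. -/
def supp (S : WordSeries A K) : Set (List A) := {w | S w ≠ 0}

/-- The scalar `c`, as a multiple of the empty word. -/
def const (c : K) : WordSeries A K
  | [] => c
  | _ :: _ => 0

open Classical in
/-- The letter `a`, as a series. -/
noncomputable def letter (a : A) : WordSeries A K := fun w => if w = [a] then 1 else 0

/-- The Cauchy product: the sum over all factorizations `w = u v` of `(S, u) (T, v)`. -/
def cauchy (S T : WordSeries A K) : WordSeries A K := fun w =>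
  ∑ i ∈ Finset.range (w.length + 1), S (w.take i) * T (w.drop i)

/-- Powers for the Cauchy product. -/
def cauchyPow (S : WordSeries A K) : ℕ → WordSeries A K
  | 0 => const 1
  | k + 1 => cauchy S (cauchyPow S k)

/-- The star `1 + S + S ^ 2 + ⋯` of a series `S` without constant term.  The coefficient at `w` of
`S ^ k` vanishes for `k` larger than the length of `w`, see `cauchyPow_eq_zero`, so that the sum is
finite at each word. -/
def star (S : WordSeries A K) : WordSeries A K := fun w =>
  ∑ k ∈ Finset.range (w.length + 1), cauchyPow S k w

theorem cauchyPow_eq_zero (S : WordSeries A K) (hS : S [] = 0) (k : ℕ) :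
    ∀ w : List A, w.length < k → cauchyPow S k w = 0 := by
  induction k with
  | zero => intro w hw; omega
  | succ k ih =>
    intro w hw
    change ∑ i ∈ Finset.range (w.length + 1), S (w.take i) * cauchyPow S k (w.drop i) = 0
    refine Finset.sum_eq_zero fun i hi => ?_
    rcases Nat.eq_zero_or_pos i with rfl | hi0
    · simp [hS]
    · by_cases hw0 : w = []
      · subst hw0; simp [hS]
      · have := List.length_pos_iff.2 hw0
        rw [ih (w.drop i) (by rw [List.length_drop]; omega), mul_zero]

/-- The right translate of `S` by `u`: the coefficient at `w` is `(S, w u)`. -/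
def translate (u : List A) (S : WordSeries A K) : WordSeries A K := fun w => S (w ++ u)

/-- The Hankel rank of `S`: the dimension of the span of its right translates. -/
noncomputable def hankelRank (S : WordSeries A K) : ℕ :=
  Module.finrank K (Submodule.span K (Set.range fun u : List A => translate u S))

end WordSeries

/-- Rational expressions over the alphabet `A` with coefficients in `K`. -/
inductive RatExpr (A K : Type*)
  | const (c : K)
  | letter (a : A)
  | add (e f : RatExpr A K)
  | mul (e f : RatExpr A K)
  | star (e : RatExpr A K)

namespace RatExpr

variable {A K : Type*}

/-- The series that a rational expression denotes. -/
noncomputable def eval [Field K] : RatExpr A K → WordSeries A K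
  | const c => WordSeries.const c
  | letter a => WordSeries.letter a
  | add e f => e.eval + f.eval
  | mul e f => WordSeries.cauchy e.eval f.eval
  | star e => WordSeries.star e.eval

/-- An expression is well formed if every star in it is applied to a series without constant
term. -/
def WellFormed [Field K] : RatExpr A K → Prop
  | const _ => True
  | letter _ => True
  | add e f => e.WellFormed ∧ f.WellFormed
  | mul e f => e.WellFormed ∧ f.WellFormed
  | star e => e.WellFormed ∧ e.eval [] = 0

/-- The symbols in which rational expressions are written: scalars, letters, and the three
operation symbols `+` (number `0`), `×` (number `1`) and `*` (number `2`). -/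
abbrev Token (A K : Type*) := (K ⊕ A) ⊕ Fin 3

/-- A rational expression, written out as a string of symbols in postfix (reverse Polish)
notation. -/
def postfixCode : RatExpr A K → List (Token A K)
  | const c => [Sum.inl (Sum.inl c)]
  | letter a => [Sum.inl (Sum.inr a)]
  | add e f => e.postfixCode ++ f.postfixCode ++ [Sum.inr 0]
  | mul e f => e.postfixCode ++ f.postfixCode ++ [Sum.inr 1]
  | star e => e.postfixCode ++ [Sum.inr 2]

end RatExpr

namespace WordSeries

/-- A series over the free monoid is rational if a well-formed rational expression denotes it. -/
def IsRational {A K : Type*} [Field K] (S : WordSeries A K) : Prop :=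
  ∃ e : RatExpr A K, e.WellFormed ∧ e.eval = S

/-- A series over the doubled alphabet `X ∪ X̄`, where `(x, true)` is the letter `x` and `(x, false)`
is its formal inverse, has reduced well-ordered support if its support consists of reduced words
and is well-ordered when reduced words are identified with the elements of the free group. -/
def HasReducedWellOrderedSupport {X K : Type*} [Field K] [LinearOrder (FreeGroup X)]
    (S : WordSeries (X × Bool) K) : Prop :=
  (∀ w ∈ S.supp, FreeGroup.IsReduced w) ∧ (FreeGroup.mk '' S.supp).IsWF

/-- `w` is the word in the support of `S` that is the minimum of the support in the order of the
free group. -/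
def IsMinSupp {X K : Type*} [Field K] [LinearOrder (FreeGroup X)]
    (S : WordSeries (X × Bool) K) (w : List (X × Bool)) : Prop :=
  w ∈ S.supp ∧ ∀ v ∈ S.supp, FreeGroup.mk w ≤ FreeGroup.mk v

end WordSeries

/-! The right translates of $S$ span a space of dimension $n$ on which words act by endomorphisms,
and each coefficient $(S,ps)$ is a functional depending on $p$ applied to a vector depending on $s$.
The argument pumps in this representation.

A long word has many consecutive nonempty factors $u_1,\dots,u_n$ acting by pseudo-regular
endomorphisms: repeated blocks either supply them or make the rank drop, and the rank cannot drop
more than $n$ times (`exists_pseudoRegular_factors_or_finrank_le`). If $pus$ is in the support and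
$u$ is pseudo-regular, then $pu^ks$ is in the support for infinitely many $k$; were $u<1$, these
words would descend forever, against well-ordering. Hence every $u_i$ is positive
(`one_lt_mk_of_isPseudoRegular`).

The $n+1$ suffixes starting at the cuts between the $u_i$ give $n+1$ vectors in dimension $n$. They
cannot be triangular with respect to the functionals of the prefixes, so some nonempty product
$u_{i+1}\cdots u_j$ can be deleted without leaving the support. Deleting a positive factor makes the
word smaller (`exists_smaller_sublist`).

So the minimum is shorter than a bound computable from any upper bound on the Hankel rank, and the
length of an expression supplies one (`RatExpr.hankelRankLE`). The algorithm computes all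
coefficients up to that length and compares. -/

/-! ### Repeated blocks and pseudo-regular endomorphisms -/

section PumpingBlocks

/-- If two terms of a list are equal, the list can be cut at their occurrences: a list of words in
which `b` occurs `j + 1` times has a concatenation of the form `p b y₁ b y₂ ⋯ b y_j b s`. -/
theorem List.flatten_eq_of_count {A : Type*} [DecidableEq (List A)]
    (b : List A) : ∀ (cs : List (List A)) (j : ℕ), j < cs.count b →
      ∃ (p : List A) (ys : List (List A)) (s : List A), ys.length = j ∧ cs.flatten = p ++ (ys.map (b ++ ·)).flatten ++ b ++ s
  | [], j, h => by simp at h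
  | c :: cs, j, h => by
    by_cases hc : c = b
    · subst hc
      rw [List.count_cons_self] at h
      cases j with
      | zero => exact ⟨[], [], cs.flatten, by simp⟩
      | succ j =>
        obtain ⟨p, ys, s, hl, he⟩ := List.flatten_eq_of_count c cs j (by omega)
        exact ⟨[], p :: ys, s, by simp [hl], by simp [he]⟩
    · rw [List.count_cons_of_ne hc] at h
      obtain ⟨p, ys, s, hl, he⟩ := List.flatten_eq_of_count b cs j h
      exact ⟨c ++ p, ys, s, hl, by simp [he]⟩

/-- A word of length at least `L * Q` begins with a product of `Q` words of length `L`. -/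
theorem List.exists_blocks {A : Type*} (L : ℕ) : ∀ (Q : ℕ) (w : List A), L * Q ≤ w.length →
    ∃ (cs : List (List A)) (s : List A), cs.length = Q ∧ (∀ c ∈ cs, c.length = L) ∧
      w = cs.flatten ++ s
  | 0, w, _ => ⟨[], w, by simp⟩
  | Q + 1, w, h => by
    rw [Nat.mul_succ] at h
    obtain ⟨cs, s, h1, h2, h3⟩ := List.exists_blocks L Q (w.drop L) (by
      rw [List.length_drop]; omega)
    refine ⟨w.take L :: cs, s, by simp [h1], ?_, ?_⟩
    · intro c hc
      rcases List.mem_cons.1 hc with rfl | hc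
      · rw [List.length_take]; omega
      · exact h2 c hc
    · rw [List.flatten_cons, List.append_assoc, ← h3, List.take_append_drop]

/-- The pigeonhole principle for the blocks of length `L` of a word over a finite alphabet. -/
theorem List.exists_repeated_block {A : Type*} [Finite A] (L m : ℕ) (w : List A)
    (h : L * (Nat.card A ^ L * m + 1) ≤ w.length) :
    ∃ (b p : List A) (ys : List (List A)) (s : List A), b.length = L ∧ ys.length = m ∧
      w = p ++ (ys.map (b ++ ·)).flatten ++ b ++ s := by
  classical
  have := Fintype.ofFinite A
  obtain ⟨cs, s, h1, h2, rfl⟩ := List.exists_blocks L _ w h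
  set F : Finset (List A) := Finset.univ.image (List.Vector.toList : List.Vector A L → List A)
  have hF : ∀ c, c ∈ F ↔ c.length = L := by
    intro c
    simp only [F, Finset.mem_image, Finset.mem_univ, true_and]
    exact ⟨fun ⟨v, hv⟩ => hv ▸ v.2, fun hc => ⟨⟨c, hc⟩, rfl⟩⟩
  have hcard : F.card ≤ Nat.card A ^ L := by
    refine Finset.card_image_le.trans ?_
    rw [Finset.card_univ, card_vector, Nat.card_eq_fintype_card]
  have hsum : ∑ c ∈ F, (cs : Multiset (List A)).count c = cs.length :=
    Multiset.sum_count_eq_card (s := F) (m := (cs : Multiset (List A)))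
      (fun a ha => (hF a).2 (h2 a (by simpa using ha)))
  -- There is one block more than `m` copies of each of the at most `Nat.card A ^ L` possible
  -- blocks.
  obtain ⟨b, hb, hlt⟩ : ∃ b ∈ F, m < (cs : Multiset (List A)).count b := by
    by_contra! hcon
    have := Finset.sum_le_card_nsmul F _ m hcon
    rw [hsum, h1, smul_eq_mul] at this
    have := this.trans (Nat.mul_le_mul_right m hcard)
    omega
  rw [Multiset.coe_count] at hlt
  obtain ⟨p, ys, t, hl, he⟩ := List.flatten_eq_of_count b cs m hlt
  exact ⟨b, p, ys, t ++ s, (hF b).1 hb, hl, by simp [he]⟩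

/-- The length beyond which a word over `k` letters contains blocks repeated `j` times in a nested
way, with `m + 1` repetitions each time. -/
def blockLength (m k : ℕ) (j : ℕ) : ℕ :=
  Nat.rec 1 (fun _ L => L * (k ^ L * m + 1)) j

theorem blockLength_succ (m k j : ℕ) :
    blockLength m k (j + 1) = blockLength m k j * (k ^ blockLength m k j * m + 1) := rfl

theorem blockLength_pos (m k j : ℕ) : 0 < blockLength m k j := by
  induction j with
  | zero => exact Nat.one_pos
  | succ j ih => exact Nat.mul_pos ih (Nat.succ_pos _)

variable {K V A : Type*} [Field K] [AddCommGroup V] [Module K V]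

/-- An endomorphism is pseudo-regular if it is injective on its range. -/
def Module.End.IsPseudoRegular (M : Module.End K V) : Prop :=
  ∀ v, M (M v) = 0 → M v = 0

theorem Module.End.finrank_range_mul_le [FiniteDimensional K V] (M N P : Module.End K V) :
    Module.finrank K (LinearMap.range (M * N * P)) ≤ Module.finrank K (LinearMap.range N) := by
  have h1 : LinearMap.range (M * N * P) ≤ (LinearMap.range N).map M := by
    rintro _ ⟨v, rfl⟩
    exact ⟨N (P v), ⟨_, rfl⟩, rfl⟩
  exact (Submodule.finrank_mono h1).trans (Submodule.finrank_map_le M _)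

/-- By rank-nullity, $BY$ is injective on the range of $B$, and this range contains that of $BY$. -/
theorem Module.End.isPseudoRegular_mul_of_finrank [FiniteDimensional K V] (B Y : Module.End K V)
    (h : Module.finrank K (LinearMap.range B) ≤ Module.finrank K (LinearMap.range (B * Y * B))) :
    (B * Y).IsPseudoRegular := by
  set f := (B * Y).domRestrict (LinearMap.range B)
  have hr : LinearMap.range f = LinearMap.range (B * Y * B) := by
    ext v
    constructor
    · rintro ⟨⟨_, u, rfl⟩, rfl⟩
      exact ⟨u, rfl⟩
    · rintro ⟨u, rfl⟩
      exact ⟨⟨B u, u, rfl⟩, rfl⟩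
  have hk : LinearMap.ker f = ⊥ := by
    have := LinearMap.finrank_range_add_finrank_ker f
    rw [hr] at this
    exact Submodule.finrank_eq_zero.1 (by omega)
  intro v hv
  have : f ⟨(B * Y) v, Y v, rfl⟩ = 0 := hv
  have := (LinearMap.ker_eq_bot'.1 hk) _ this
  exact congrArg Subtype.val this

/-- A long word either contains `m` consecutive nonempty factors with pseudo-regular images or has
an image of small rank. -/
theorem exists_pseudoRegular_factors_or_finrank_le [Finite A] [FiniteDimensional K V]
    (T : List A → Module.End K V) (hT : ∀ u v, T (u ++ v) = T u * T v) (m j : ℕ) :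
    ∀ w : List A, blockLength m (Nat.card A) j ≤ w.length →
      (∃ (p : List A) (us : List (List A)) (s : List A), w = p ++ us.flatten ++ s ∧ us.length = m ∧
        ∀ u ∈ us, u ≠ [] ∧ (T u).IsPseudoRegular) ∨
      Module.finrank K (LinearMap.range (T w)) + j ≤ Module.finrank K V := by
  have hfactor : ∀ u v w, Module.finrank K (LinearMap.range (T (u ++ v ++ w))) ≤
      Module.finrank K (LinearMap.range (T v)) := by
    intro u v w
    rw [hT, hT]
    exact Module.End.finrank_range_mul_le _ _ _
  induction j with
  | zero => exact fun w _ => Or.inr (Submodule.finrank_le _)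
  | succ j ih =>
    intro w hw
    rw [blockLength_succ] at hw
    have hpos := blockLength_pos m (Nat.card A) j
    generalize blockLength m (Nat.card A) j = L at ih hw hpos
    obtain ⟨b, p, ys, s, hb, hys, rfl⟩ := List.exists_repeated_block L m w hw
    rcases ih b hb.ge with ⟨p', us, s', rfl, hus, hu⟩ | hr
    -- Factors found inside the block are factors of the whole word; the last occurrence of the
    -- block is used.
    · exact Or.inl ⟨p ++ (ys.map ((p' ++ us.flatten ++ s') ++ ·)).flatten ++ p', us, s' ++ s,
        by simp, hus, hu⟩
    have hle := hfactor (p ++ (ys.map (b ++ ·)).flatten) b s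
    by_cases hlt : Module.finrank K (LinearMap.range
        (T (p ++ (ys.map (b ++ ·)).flatten ++ b ++ s))) < Module.finrank K (LinearMap.range (T b))
    · right; omega
    -- The rank of the whole word equals that of `b`, so each intermediate factor `b y b` also has
    -- at least the rank of `b`.
    · left
      refine ⟨p, ys.map (b ++ ·), b ++ s, by simp, by simp [hys], ?_⟩
      intro u hu
      obtain ⟨y, hy, rfl⟩ := List.mem_map.1 hu
      refine ⟨fun h => ?_, ?_⟩
      · have := congrArg List.length h
        simp only [List.length_append, List.length_nil] at this
        omega
      · rw [hT]
        refine Module.End.isPseudoRegular_mul_of_finrank _ _ ((not_lt.1 hlt).trans ?_)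
        obtain ⟨l₁, l₂, rfl⟩ := List.append_of_mem hy
        -- Each `y` is followed by a `b`: that of the next pair, or the final one.
        obtain ⟨t, ht⟩ : ∃ t, (l₂.map (b ++ ·)).flatten ++ b = b ++ t := by
          cases l₂ with
          | nil => exact ⟨[], by simp⟩
          | cons c l₂ => exact ⟨c ++ ((l₂.map (b ++ ·)).flatten ++ b), by simp⟩
        rw [← hT, ← hT]
        have hts : (l₂.map (b ++ ·)).flatten ++ (b ++ s) = b ++ (t ++ s) := by
          rw [← List.append_assoc, ht, List.append_assoc]
        have he : p ++ ((l₁ ++ y :: l₂).map (b ++ ·)).flatten ++ b ++ s =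
            p ++ (l₁.map (b ++ ·)).flatten ++ (b ++ y ++ b) ++ (t ++ s) := by
          simp [hts]
        rw [he]
        exact hfactor _ _ _

/-- The orbit of a vector under a pseudo-regular endomorphism comes back infinitely often outside
the kernel of a functional that does not vanish on its first iterate. -/
theorem Module.End.IsPseudoRegular.exists_lt_ne_zero [FiniteDimensional K V]
    {M : Module.End K V} (hM : M.IsPseudoRegular) (φ : V →ₗ[K] K) (v : V) (h : φ (M v) ≠ 0)
    (n : ℕ) : ∃ k, n < k ∧ φ ((M ^ k) v) ≠ 0 := by
  by_contra! hcon
  let W : ℕ → Submodule K V := fun j => Submodule.span K {x | ∃ k, j < k ∧ x = (M ^ k) v}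
  have hanti : ∀ j, W (j + 1) ≤ W j := fun j =>
    Submodule.span_mono fun x ⟨k, hk, hx⟩ => ⟨k, by omega, hx⟩
  have hmap : ∀ j, (W j).map M ≤ W (j + 1) := by
    intro j
    rw [Submodule.map_span, Submodule.span_le]
    rintro _ ⟨_, ⟨k, hk, rfl⟩, rfl⟩
    refine Submodule.subset_span ⟨k + 1, by omega, ?_⟩
    rw [pow_succ']; rfl
  have hrange : ∀ j, W j ≤ LinearMap.range M := by
    intro j
    refine Submodule.span_le.2 ?_
    rintro _ ⟨k, hk, rfl⟩
    obtain ⟨k, rfl⟩ := Nat.exists_eq_succ_of_ne_zero (Nat.ne_of_gt (Nat.zero_lt_of_lt hk))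
    rw [pow_succ']
    exact ⟨_, rfl⟩
  -- `M` is injective on its range, which contains `W j` since only positive exponents occur; so it
  -- embeds `W j` into `W (j + 1)`, and dimensions force equality.
  have heq : ∀ j, W (j + 1) = W j := by
    intro j
    refine Submodule.eq_of_le_of_finrank_le (hanti j) ?_
    have hinj : Function.Injective (M.domRestrict (W j)) := by
      refine LinearMap.ker_eq_bot.1 (LinearMap.ker_eq_bot'.2 ?_)
      rintro ⟨x, hx⟩ hx0
      obtain ⟨y, rfl⟩ := hrange j hx
      exact Subtype.ext (hM y hx0)
    have h1 := LinearMap.finrank_range_of_inj hinj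
    rw [← h1]
    refine Submodule.finrank_mono (le_trans ?_ (hmap j))
    rintro _ ⟨⟨x, hx⟩, rfl⟩
    exact ⟨x, hx, rfl⟩
  have hall : ∀ j, W j = W 0 := fun j => by
    induction j with
    | zero => rfl
    | succ j ih => rw [heq, ih]
  have hmem : M v ∈ W n := by
    rw [hall]
    exact Submodule.subset_span ⟨1, one_pos, by simp⟩
  have hker : W n ≤ LinearMap.ker φ := by
    refine Submodule.span_le.2 ?_
    rintro _ ⟨k, hk, rfl⟩
    exact hcon k hk
  exact h (hker hmem)

/-- Vectors that are triangular with respect to a family of functionals are independent. -/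
theorem linearIndependent_of_triangular {m : ℕ} (φ : Fin m → V →ₗ[K] K) (v : Fin m → V)
    (h1 : ∀ i, φ i (v i) ≠ 0) (h2 : ∀ i j, i < j → φ i (v j) = 0) : LinearIndependent K v := by
  rw [Fintype.linearIndependent_iff]
  classical
  intro g hg
  by_contra! hcon
  have hne : (Finset.univ.filter fun i => g i ≠ 0).Nonempty := by
    obtain ⟨i, hi⟩ := hcon
    exact ⟨i, by simpa using hi⟩
  -- At the least index with nonzero coefficient, `φ i` kills all later terms and the earlier ones
  -- have coefficient zero.
  set i := (Finset.univ.filter fun i => g i ≠ 0).min' hne with hi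
  have hgi : g i ≠ 0 := by
    have := Finset.min'_mem _ hne
    rw [← hi] at this
    simpa using this
  have hmin : ∀ j, j < i → g j = 0 := by
    intro j hj
    by_contra hgj
    exact absurd (Finset.min'_le _ j (by simpa using hgj)) (not_le.2 hj)
  have := congrArg (φ i) hg
  rw [map_sum, map_zero, Finset.sum_eq_single i] at this
  · rw [map_smul, smul_eq_mul] at this
    exact (mul_ne_zero hgi (h1 i)) this
  · intro j _ hj
    rw [map_smul, smul_eq_mul]
    rcases lt_or_gt_of_ne hj with hj | hj
    · rw [hmin j hj, zero_mul]
    · rw [h2 i j hj, mul_zero]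
  · simp

end PumpingBlocks

/-! ### The Hankel representation and deletion of positive factors -/

namespace WordSeries

variable {A K : Type*} [Field K]

/-- The span of the right translates of `S`. -/
def hankelSpace (S : WordSeries A K) : Submodule K (WordSeries A K) :=
  Submodule.span K (Set.range fun u : List A => translate u S)

theorem translate_translate {A K : Type*} (u v : List A) (S : WordSeries A K) :
    translate u (translate v S) = translate (u ++ v) S := by
  funext w
  simp [translate]

/-- Translation as a linear map. -/
def translateₗ (u : List A) : WordSeries A K →ₗ[K] WordSeries A K where
  toFun := translate u
  map_add' _ _ := rfl
  map_smul' _ _ := rfl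

theorem translateₗ_mem_hankelSpace (S : WordSeries A K) (u : List A) :
    ∀ f ∈ S.hankelSpace, translateₗ u f ∈ S.hankelSpace := by
  intro f hf
  have : S.hankelSpace ≤ S.hankelSpace.comap (translateₗ u) := by
    refine Submodule.span_le.2 ?_
    rintro _ ⟨v, rfl⟩
    exact Submodule.subset_span ⟨u ++ v, (translate_translate u v S).symm⟩
  exact this hf

/-- The action of words on the Hankel space. -/
def hankelAction (S : WordSeries A K) (u : List A) : Module.End K S.hankelSpace :=
  (translateₗ u).restrict (translateₗ_mem_hankelSpace S u)

/-- Right translates give a left action, so a factorization becomes a product of endomorphisms in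
the same order. -/
theorem hankelAction_append (S : WordSeries A K) (u v : List A) :
    S.hankelAction (u ++ v) = S.hankelAction u * S.hankelAction v := by
  ext f : 2
  exact (translate_translate u v f.1).symm

theorem hankelAction_pow (S : WordSeries A K) (u : List A) (k : ℕ) :
    S.hankelAction u ^ k = S.hankelAction (List.replicate k u).flatten := by
  induction k with
  | zero =>
    ext f w
    simp [hankelAction, translateₗ, translate]
  | succ k ih => rw [pow_succ', ih, List.replicate_succ, List.flatten_cons, hankelAction_append]

/-- The series as an element of its Hankel space. -/
def hankelVector (S : WordSeries A K) : S.hankelSpace :=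
  ⟨S, Submodule.subset_span ⟨[], by funext w; simp [translate]⟩⟩

/-- The coefficient at a word, as a functional. -/
def hankelCoeff (S : WordSeries A K) (w : List A) : S.hankelSpace →ₗ[K] K where
  toFun f := f.1 w
  map_add' _ _ := rfl
  map_smul' _ _ := rfl

/-- Separates prefix from suffix at a cut, so that the two can be varied independently. -/
theorem hankelCoeff_action_vector (S : WordSeries A K) (p s : List A) :
    S.hankelCoeff p (S.hankelAction s S.hankelVector) = S (p ++ s) := rfl

section Order

variable {X : Type*} [LinearOrder (FreeGroup X)] [MulLeftMono (FreeGroup X)]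
  [MulRightMono (FreeGroup X)]

/-- A factor of a word in the support that acts in a pseudo-regular way is positive. -/
theorem one_lt_mk_of_isPseudoRegular {S : WordSeries (X × Bool) K}
    [FiniteDimensional K S.hankelSpace] (hS : S.HasReducedWellOrderedSupport)
    {p u s : List (X × Bool)} (hw : p ++ u ++ s ∈ S.supp) (hu : u ≠ [])
    (hreg : (S.hankelAction u).IsPseudoRegular) : 1 < FreeGroup.mk u := by
  classical
  have hne : FreeGroup.mk u ≠ 1 := by
    intro h
    have h1 : FreeGroup.IsReduced u := (hS.1 _ hw).infix ⟨p, s, rfl⟩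
    rw [FreeGroup.one_eq_mk, ← FreeGroup.toWord_inj, FreeGroup.toWord_mk, FreeGroup.toWord_mk,
      h1.reduce_eq] at h
    exact hu (by simpa using h)
  by_contra hlt
  have hlt : FreeGroup.mk u < 1 := lt_of_le_of_ne (not_lt.1 hlt) hne
  let g : ℕ → FreeGroup X := fun k => FreeGroup.mk p * FreeGroup.mk u ^ k * FreeGroup.mk s
  have hg : StrictAnti g := by
    refine strictAnti_nat_of_succ_lt fun k => ?_
    refine mul_lt_mul_left (mul_lt_mul_right ?_ _) _
    rw [pow_succ]
    exact mul_lt_of_lt_one_right' _ hlt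
  have hmk : ∀ k, FreeGroup.mk (p ++ (List.replicate k u).flatten ++ s) = g k := by
    intro k
    rw [← FreeGroup.mul_mk, ← FreeGroup.mul_mk, ← FreeGroup.pow_mk]
  have hcoeff : ∀ k, S.hankelCoeff p ((S.hankelAction u ^ k)
      (S.hankelAction s S.hankelVector)) = S (p ++ (List.replicate k u).flatten ++ s) := by
    intro k
    rw [hankelAction_pow]; rfl
  -- The nonvanishing on the first iterate is `hw`, read through the representation.
  have hinf := hreg.exists_lt_ne_zero (S.hankelCoeff p) (S.hankelAction s S.hankelVector) hw
  have hsub : g '' {k | S (p ++ (List.replicate k u).flatten ++ s) ≠ 0} ⊆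
      FreeGroup.mk '' S.supp := by
    rintro _ ⟨k, hk, rfl⟩
    exact ⟨_, hk, hmk k⟩
  have hwf := hS.2.mono hsub
  have hnon : (g '' {k | S (p ++ (List.replicate k u).flatten ++ s) ≠ 0}).Nonempty := by
    obtain ⟨k, _, hk⟩ := hinf 0
    rw [hcoeff] at hk
    exact ⟨_, k, hk, rfl⟩
  obtain ⟨k, hk, hkm⟩ := hwf.min_mem hnon
  obtain ⟨k', hkk, hk'⟩ := hinf k
  rw [hcoeff] at hk'
  refine hwf.not_lt_min hnon ⟨k', hk', rfl⟩ ?_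
  rw [← hkm]
  exact hg hkk

/-- Long words in the support have smaller subwords in the support. -/
theorem exists_smaller_sublist [Finite X] {S : WordSeries (X × Bool) K}
    [FiniteDimensional K S.hankelSpace] (hS : S.HasReducedWellOrderedSupport) {n : ℕ}
    (hn : S.hankelRank ≤ n) {w : List (X × Bool)} (hw : w ∈ S.supp)
    (hlen : blockLength n (2 * Nat.card X) (n + 1) ≤ w.length) :
    ∃ v ∈ S.supp, v.Sublist w ∧ FreeGroup.mk v < FreeGroup.mk w := by
  have hn' : Module.finrank K S.hankelSpace ≤ n := hn
  have hcard : 2 * Nat.card X = Nat.card (X × Bool) := by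
    rw [Nat.card_prod, Nat.card_eq_fintype_card (α := Bool), Fintype.card_bool, mul_comm]
  rw [hcard] at hlen
  rcases exists_pseudoRegular_factors_or_finrank_le S.hankelAction S.hankelAction_append n (n + 1)
    w hlen with ⟨p, us, s, rfl, hus, hu⟩ | h
  swap
  -- A rank deficit of `n + 1` is impossible in dimension at most `n`.
  · omega
  have hpos : ∀ u ∈ us, 1 < FreeGroup.mk u := by
    intro u hmem
    obtain ⟨l₁, l₂, rfl⟩ := List.append_of_mem hmem
    refine one_lt_mk_of_isPseudoRegular hS (p := p ++ l₁.flatten) (s := l₂.flatten ++ s) ?_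
      (hu u hmem).1 (hu u hmem).2
    simpa using hw
  have hposflat : ∀ l : List (List (X × Bool)), (∀ u ∈ l, 1 < FreeGroup.mk u) → l ≠ [] →
      1 < FreeGroup.mk l.flatten := by
    intro l
    induction l with
    | nil => intro _ h; exact absurd rfl h
    | cons a l ih =>
      intro h _
      rw [List.flatten_cons, ← FreeGroup.mul_mk]
      have ha := h a (by simp)
      rcases eq_or_ne l [] with rfl | hl
      · simpa [← FreeGroup.one_eq_mk] using ha
      · exact one_lt_mul'' ha (ih (fun u hu => h u (by simp [hu])) hl)
  let v : Fin (n + 1) → S.hankelSpace := fun j =>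
    S.hankelAction ((us.drop j).flatten ++ s) S.hankelVector
  let φ : Fin (n + 1) → S.hankelSpace →ₗ[K] K := fun i =>
    S.hankelCoeff (p ++ (us.take i).flatten)
  have hφ : ∀ i j, φ i (v j) = S (p ++ (us.take i).flatten ++ (us.drop j).flatten ++ s) := by
    intro i j
    simp only [φ, v, hankelCoeff_action_vector, List.append_assoc]
  -- The diagonal values are all the coefficient of `w`, hence nonzero; vanishing above the diagonal
  -- would make `n + 1` vectors independent.
  obtain ⟨i, j, hij, hne⟩ : ∃ i j, i < j ∧ φ i (v j) ≠ 0 := by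
    by_contra! hcon
    have hli := linearIndependent_of_triangular φ v (fun i => ?_) hcon
    · have := hli.fintype_card_le_finrank
      rw [Fintype.card_fin] at this
      omega
    · rw [hφ, List.append_assoc p, ← List.flatten_append, List.take_append_drop]
      exact hw
  rw [hφ] at hne
  have hij' : (i : ℕ) < j := hij
  have hsplit : us = us.take i ++ ((us.drop i).take (j - i) ++ us.drop j) := by
    have : us.drop j = (us.drop i).drop (j - i) := by
      rw [List.drop_drop]; congr 1; omega
    rw [this, List.take_append_drop, List.take_append_drop]
  have hw' : p ++ us.flatten ++ s = p ++ (us.take i).flatten ++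
      ((us.drop i).take (j - i)).flatten ++ ((us.drop j).flatten ++ s) := by
    conv_lhs => rw [hsplit]
    simp only [List.flatten_append, List.append_assoc]
  have hmid : 1 < FreeGroup.mk ((us.drop i).take (j - i)).flatten := by
    refine hposflat _ (fun u hu => hpos u (List.mem_of_mem_drop (List.mem_of_mem_take hu))) ?_
    rw [← List.length_pos_iff, List.length_take, List.length_drop]
    omega
  refine ⟨_, hne, ?_, ?_⟩
  · rw [hw', List.append_assoc _ _ s]
    exact (List.sublist_append_left _ _).append (List.Sublist.refl _)
  · rw [hw', List.append_assoc _ _ s, ← FreeGroup.mul_mk (L₁ := p ++ (us.take i).flatten),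
      ← FreeGroup.mul_mk (L₁ := p ++ (us.take i).flatten ++ _),
      ← FreeGroup.mul_mk (L₁ := p ++ (us.take i).flatten)]
    exact mul_lt_mul_left (lt_mul_of_one_lt_right' _ hmid) _

end Order

end WordSeries

/-! ### Hankel rank of sums, products and stars -/

namespace WordSeries

variable {A K : Type*} [Field K]

theorem cauchy_nil (S T : WordSeries A K) : cauchy S T [] = S [] * T [] := by
  simp [cauchy]

theorem cauchy_cons (S T : WordSeries A K) (a : A) (w : List A) :
    cauchy S T (a :: w) = S [] * T (a :: w) + cauchy (fun v => S (a :: v)) T w := by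
  simp only [cauchy, List.length_cons]
  rw [Finset.sum_range_succ']
  simp [add_comm]

theorem cauchy_add_left (S S' T : WordSeries A K) :
    cauchy (S + S') T = cauchy S T + cauchy S' T := by
  funext w
  simp [cauchy, add_mul, Finset.sum_add_distrib]

theorem cauchy_smul_left (c : K) (S T : WordSeries A K) :
    cauchy (c • S) T = c • cauchy S T := by
  funext w
  simp [cauchy, mul_assoc, Finset.mul_sum]

theorem cauchy_const_left (c : K) (T : WordSeries A K) : cauchy (const c) T = c • T := by
  funext w
  rw [cauchy, Finset.sum_range_succ', Finset.sum_eq_zero]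
  · simp [const]
  · intro i hi
    cases w with
    | nil => simp at hi
    | cons a w => simp [const]

theorem cauchy_assoc (S T U : WordSeries A K) :
    cauchy (cauchy S T) U = cauchy S (cauchy T U) := by
  funext w
  induction w generalizing S with
  | nil => simp [cauchy_nil, mul_assoc]
  | cons a w ih =>
    have h : (fun v => cauchy S T (a :: v)) =
        S [] • (fun v => T (a :: v)) + cauchy (fun v => S (a :: v)) T := by
      funext v
      exact cauchy_cons S T a v
    rw [cauchy_cons, h, cauchy_add_left, cauchy_smul_left, Pi.add_apply, ih, cauchy_cons S,
      cauchy_cons T, cauchy_nil]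
    simp only [Pi.smul_apply, smul_eq_mul]
    ring

/-- Left multiplication by a series, as a linear map. -/
def cauchyₗ (S : WordSeries A K) : WordSeries A K →ₗ[K] WordSeries A K where
  toFun := cauchy S
  map_add' T T' := by
    funext w
    simp [cauchy, mul_add, Finset.sum_add_distrib]
  map_smul' c T := by
    funext w
    simp [cauchy, mul_left_comm, Finset.mul_sum]

theorem translate_const (a : A) (c : K) : translate [a] (const c) = 0 := by
  funext w
  cases w <;> rfl

theorem translate_letter (a b : A) : translate [b] (letter a : WordSeries A K) = const 1 ∨
    translate [b] (letter a : WordSeries A K) = 0 := by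
  by_cases h : b = a
  · subst h
    left
    funext w
    cases w <;> simp [translate, letter, const]
  · right
    funext w
    cases w <;> simp [translate, letter, h]

/-- In a factorization of $wa$, either the second factor ends in $a$ or it is empty. -/
theorem translate_cauchy (a : A) (S T : WordSeries A K) :
    translate [a] (cauchy S T) = cauchy S (translate [a] T) + T [] • translate [a] S := by
  funext w
  simp only [translate, cauchy, Pi.add_apply, Pi.smul_apply, smul_eq_mul]
  rw [List.length_append, List.length_singleton, Finset.sum_range_succ]
  congr 1
  · refine Finset.sum_congr rfl fun i hi => ?_
    have hi : i ≤ w.length := by simpa [Nat.lt_succ_iff] using hi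
    rw [List.take_append_of_le_length hi, List.drop_append_of_le_length hi]
  · rw [List.take_of_length_le (by simp), List.drop_of_length_le (by simp), mul_comm]

/-- Lets one truncation serve all words up to a given length, so that sums can be exchanged. -/
theorem star_apply_of_lt {S : WordSeries A K} (hS : S [] = 0) {w : List A} {n : ℕ}
    (hn : w.length < n) : star S w = ∑ k ∈ Finset.range n, cauchyPow S k w := by
  refine Finset.sum_subset (Finset.range_subset_range.2 hn) fun k _ hk => ?_
  exact cauchyPow_eq_zero S hS k w (by simpa [Nat.lt_succ_iff] using hk)

/-- Without constant term, the last factor must supply the final letter. Powers grow on the left,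
hence the use of associativity. -/
theorem translate_cauchyPow_succ {S : WordSeries A K} (hS : S [] = 0) (a : A) (k : ℕ) :
    translate [a] (cauchyPow S (k + 1)) = cauchy (cauchyPow S k) (translate [a] S) := by
  induction k with
  | zero =>
    simp only [cauchyPow]
    rw [translate_cauchy, translate_const, cauchy_const_left]
    change cauchyₗ S 0 + (1 : K) • _ = _
    rw [map_zero, zero_add]
  | succ k ih =>
    rw [cauchyPow, translate_cauchy, ih, cauchyPow_eq_zero S hS (k + 1) [] (by simp), zero_smul,
      add_zero, ← cauchy_assoc]
    rfl

theorem translate_star {S : WordSeries A K} (hS : S [] = 0) (a : A) :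
    translate [a] (star S) = cauchy (star S) (translate [a] S) := by
  funext w
  have h : ∀ k, cauchyPow S (k + 1) (w ++ [a]) = cauchy (cauchyPow S k) (translate [a] S) w :=
    fun k => congrFun (translate_cauchyPow_succ hS a k) w
  have h0 : cauchyPow S 0 (w ++ [a]) = 0 := congrFun (translate_const a 1) w
  rw [translate, star_apply_of_lt hS (n := w.length + 1 + 1) (by simp),
    Finset.sum_range_succ', h0, add_zero]
  simp only [h, cauchy]
  rw [Finset.sum_comm]
  refine Finset.sum_congr rfl fun i _ => ?_
  rw [star_apply_of_lt hS (n := w.length + 1) (by rw [List.length_take]; omega), Finset.sum_mul]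

theorem translate_mem_hankelSpace (S : WordSeries A K) (u : List A) :
    ∀ f ∈ S.hankelSpace, translate u f ∈ S.hankelSpace :=
  translateₗ_mem_hankelSpace S u

/-- Reduces each rank bound to exhibiting a small subspace stable under translation by letters. -/
theorem hankelSpace_le {S : WordSeries A K} {W : Submodule K (WordSeries A K)} (hS : S ∈ W)
    (hW : ∀ a, ∀ f ∈ W, translate [a] f ∈ W) : S.hankelSpace ≤ W := by
  refine Submodule.span_le.2 ?_
  rintro _ ⟨u, rfl⟩
  change translate u S ∈ W
  induction u with
  | nil =>
    have : translate [] S = S := by funext w; simp [translate]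
    rwa [this]
  | cons a u ih =>
    have := hW a _ ih
    rwa [translate_translate] at this

theorem translate_mem_of_mem_span {s : Set (WordSeries A K)}
    {W : Submodule K (WordSeries A K)} {u : List A} (h : ∀ f ∈ s, translate u f ∈ W) :
    ∀ f ∈ Submodule.span K s, translate u f ∈ W :=
  have : Submodule.span K s ≤ W.comap (translateₗ u) := Submodule.span_le.2 h
  this

theorem translate_mem_of_mem_sup {W₁ W₂ W : Submodule K (WordSeries A K)} {u : List A}
    (h₁ : ∀ f ∈ W₁, translate u f ∈ W) (h₂ : ∀ f ∈ W₂, translate u f ∈ W) :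
    ∀ f ∈ W₁ ⊔ W₂, translate u f ∈ W :=
  have : W₁ ⊔ W₂ ≤ W.comap (translateₗ u) := sup_le h₁ h₂
  this

theorem finrank_span_singleton_le_one (S : WordSeries A K) :
    Module.finrank K (Submodule.span K {S}) ≤ 1 :=
  (finrank_span_le_card {S}).trans (by simp)

theorem mem_hankelSpace (S : WordSeries A K) : S ∈ S.hankelSpace := S.hankelVector.2

/-- The Hankel space of `S` has dimension at most `n`. -/
def HankelRankLE (S : WordSeries A K) (n : ℕ) : Prop :=
  FiniteDimensional K S.hankelSpace ∧ Module.finrank K S.hankelSpace ≤ n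

theorem HankelRankLE.of_le {S : WordSeries A K} {W : Submodule K (WordSeries A K)} {n : ℕ}
    (h : S.hankelSpace ≤ W) (hW : FiniteDimensional K W) (hn : Module.finrank K W ≤ n) :
    S.HankelRankLE n :=
  ⟨Submodule.finiteDimensional_of_le h, (Submodule.finrank_mono h).trans hn⟩

theorem hankelRankLE_const (c : K) : (const c : WordSeries A K).HankelRankLE 1 := by
  refine HankelRankLE.of_le (W := Submodule.span K {const c}) (hankelSpace_le
    (Submodule.mem_span_singleton_self _) fun a => translate_mem_of_mem_span fun f hf => ?_)
    inferInstance (finrank_span_singleton_le_one _)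
  rw [Set.mem_singleton_iff.1 hf, translate_const]
  exact zero_mem _

theorem hankelRankLE_letter (a : A) : (letter a : WordSeries A K).HankelRankLE 2 := by
  have h1 : const 1 ∈ Submodule.span K {(letter a : WordSeries A K)} ⊔
      Submodule.span K {(const 1 : WordSeries A K)} :=
    Submodule.mem_sup_right (Submodule.mem_span_singleton_self _)
  refine HankelRankLE.of_le
    (W := Submodule.span K {letter a} ⊔ Submodule.span K {const 1})
    (hankelSpace_le (Submodule.mem_sup_left (Submodule.mem_span_singleton_self _)) fun b =>
      translate_mem_of_mem_sup (translate_mem_of_mem_span fun f hf => ?_)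
        (translate_mem_of_mem_span fun f hf => ?_)) inferInstance
    ((Submodule.finrank_add_le_finrank_add_finrank _ _).trans
      (add_le_add (finrank_span_singleton_le_one _) (finrank_span_singleton_le_one _)))
  · rw [Set.mem_singleton_iff.1 hf]
    rcases translate_letter (K := K) a b with h | h
    · rwa [h]
    · rw [h]
      exact zero_mem _
  · rw [Set.mem_singleton_iff.1 hf, translate_const]
    exact zero_mem _

theorem HankelRankLE.add {S T : WordSeries A K} {m n : ℕ} (hS : S.HankelRankLE m)
    (hT : T.HankelRankLE n) : (S + T).HankelRankLE (m + n) := by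
  have := hS.1
  have := hT.1
  refine HankelRankLE.of_le (W := S.hankelSpace ⊔ T.hankelSpace) (hankelSpace_le
    (Submodule.add_mem_sup S.mem_hankelSpace T.mem_hankelSpace) fun a => ?_) inferInstance
    ((Submodule.finrank_add_le_finrank_add_finrank _ _).trans (add_le_add hS.2 hT.2))
  exact translate_mem_of_mem_sup
    (fun f hf => Submodule.mem_sup_left (translate_mem_hankelSpace S [a] f hf))
    (fun f hf => Submodule.mem_sup_right (translate_mem_hankelSpace T [a] f hf))

theorem HankelRankLE.cauchy {S T : WordSeries A K} {m n : ℕ} (hS : S.HankelRankLE m)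
    (hT : T.HankelRankLE n) : (cauchy S T).HankelRankLE (m + n) := by
  have := hS.1
  have := hT.1
  -- Stability of $S\cdot H(T)+H(S)$, with $H$ the Hankel space, is the formula of
  -- `translate_cauchy`.
  refine HankelRankLE.of_le (W := T.hankelSpace.map (cauchyₗ S) ⊔ S.hankelSpace) (hankelSpace_le
    (Submodule.mem_sup_left ⟨T, T.mem_hankelSpace, rfl⟩) fun a => ?_) inferInstance
    ((Submodule.finrank_add_le_finrank_add_finrank _ _).trans ?_)
  · refine translate_mem_of_mem_sup ?_
      (fun f hf => Submodule.mem_sup_right (translate_mem_hankelSpace S [a] f hf))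
    rintro _ ⟨f, hf, rfl⟩
    change translate [a] (WordSeries.cauchy S f) ∈ _
    rw [translate_cauchy]
    exact Submodule.add_mem_sup ⟨_, translateₗ_mem_hankelSpace T [a] f hf, rfl⟩
      (Submodule.smul_mem _ _ (translate_mem_hankelSpace S [a] S S.mem_hankelSpace))
  · rw [add_comm m]
    exact add_le_add ((Submodule.finrank_map_le _ _).trans hT.2) hS.2

theorem HankelRankLE.star {S : WordSeries A K} {n : ℕ} (hS : S.HankelRankLE n)
    (h0 : S [] = 0) : (star S).HankelRankLE (n + 1) := by
  have := hS.1
  -- Translating $S^*$ lands in $S^*\cdot H(S)$, so only the line of $S^*$ itself has to be added.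
  refine HankelRankLE.of_le
    (W := S.hankelSpace.map (cauchyₗ (WordSeries.star S)) ⊔
      Submodule.span K {WordSeries.star S})
    (hankelSpace_le (Submodule.mem_sup_right (Submodule.mem_span_singleton_self _))
      fun a => ?_) inferInstance
    ((Submodule.finrank_add_le_finrank_add_finrank _ _).trans
      (add_le_add ((Submodule.finrank_map_le _ _).trans hS.2) (finrank_span_singleton_le_one _)))
  have hmem : ∀ f ∈ S.hankelSpace, WordSeries.cauchy (WordSeries.star S) f ∈
      S.hankelSpace.map (cauchyₗ (WordSeries.star S)) := fun f hf => ⟨f, hf, rfl⟩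
  have htr := translate_mem_hankelSpace S [a]
  refine translate_mem_of_mem_sup ?_ (translate_mem_of_mem_span fun f hf => ?_)
  · rintro _ ⟨f, hf, rfl⟩
    change translate [a] (WordSeries.cauchy (WordSeries.star S) f) ∈ _
    rw [translate_cauchy, translate_star h0]
    exact Submodule.mem_sup_left (add_mem (hmem _ (htr f hf))
      (Submodule.smul_mem _ _ (hmem _ (htr S S.mem_hankelSpace))))
  · rw [Set.mem_singleton_iff.1 hf, translate_star h0]
    exact Submodule.mem_sup_left (hmem _ (htr S S.mem_hankelSpace))

end WordSeries

/-- A scalar costs at most 1, a letter 2, a star 1 more, sums and products nothing more; two per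
symbol suffices. The bound depends on the code alone, so the rank itself need not be computed. -/
theorem RatExpr.hankelRankLE {A K : Type*} [Field K] (e : RatExpr A K) (he : e.WellFormed) :
    e.eval.HankelRankLE (2 * e.postfixCode.length) := by
  have mono : ∀ {S : WordSeries A K} {m n : ℕ}, m ≤ n → S.HankelRankLE m → S.HankelRankLE n :=
    fun hmn h => ⟨h.1, h.2.trans hmn⟩
  induction e with
  | const c => exact mono (by simp [postfixCode]) (WordSeries.hankelRankLE_const c)
  | letter a => exact mono (by simp [postfixCode]) (WordSeries.hankelRankLE_letter a)
  | add e f ihe ihf =>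
    refine mono ?_ ((ihe he.1).add (ihf he.2))
    simp only [postfixCode, List.length_append]
    omega
  | mul e f ihe ihf =>
    refine mono ?_ ((ihe he.1).cauchy (ihf he.2))
    simp only [postfixCode, List.length_append]
    omega
  | star e ih =>
    refine mono ?_ ((ih he.1).star he.2)
    simp only [postfixCode, List.length_append, List.length_singleton]
    omega

/-! ### Computability of folds, finite sums and the length bound -/

namespace Computable

variable {α β σ : Type*} [Primcodable α] [Primcodable β] [Primcodable σ]

/-- Recursion on the number of entries already read, the counter serving as index of the next one.
-/
theorem list_foldl {f : α → List β} {g : α → σ} {h : α → σ × β → σ} (hf : Computable f)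
    (hg : Computable g) (hh : Computable₂ h) :
    Computable fun a => (f a).foldl (fun s b => h a (s, b)) (g a) := by
  have key : Computable fun a => Nat.rec (motive := fun _ => σ) (g a)
      (fun y s => Option.casesOn (motive := fun _ => σ) (f a)[y]? s fun b => h a (s, b))
      (f a).length := by
    refine nat_rec (h := fun a p => Option.casesOn (motive := fun _ => σ) (f a)[p.1]? p.2
      fun b => h a (p.2, b)) (list_length.comp hf) hg ?_
    refine option_casesOn (o := fun q : α × ℕ × σ => (f q.1)[q.2.1]?)
      (list_getElem?.comp (hf.comp fst) (fst.comp snd)) (snd.comp snd) ?_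
    exact hh.comp (fst.comp fst) ((snd.comp (snd.comp fst)).pair snd)
  refine key.of_eq fun a => ?_
  have : ∀ n, Nat.rec (motive := fun _ => σ) (g a)
      (fun y s => Option.casesOn (motive := fun _ => σ) (f a)[y]? s fun b => h a (s, b)) n =
      ((f a).take n).foldl (fun s b => h a (s, b)) (g a) := by
    intro n
    induction n with
    | zero => simp
    | succ n ih =>
      rw [List.take_add_one, List.foldl_append, ← ih]
      cases hn : (f a)[n]? <;> simp [hn]
  rw [this, List.take_length]

theorem list_map {f : α → List β} {g : α → β → σ} (hf : Computable f) (hg : Computable₂ g) :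
    Computable fun a => (f a).map (g a) := by
  have key : Computable fun a => (f a).foldl (fun s b => s ++ [g a b]) [] :=
    list_foldl (h := fun a (p : List σ × β) => p.1 ++ [g a p.2]) hf (const [])
      (list_concat.comp (fst.comp snd) (hg.comp fst (snd.comp snd)))
  refine key.of_eq fun a => ?_
  have : ∀ (l : List β) (s : List σ), l.foldl (fun s b => s ++ [g a b]) s = s ++ l.map (g a) := by
    intro l
    induction l with
    | nil => simp
    | cons b l ih => simp [ih]
  simpa using this (f a) []

theorem list_tail {f : α → List β} (hf : Computable f) : Computable fun a => (f a).tail :=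
  Primrec.list_tail.to_comp.comp hf

theorem list_headI [Inhabited β] {f : α → List β} (hf : Computable f) :
    Computable fun a => (f a).headI :=
  Primrec.list_headI.to_comp.comp hf

theorem sum_range {M : Type*} [AddCommMonoid M] [Primcodable M]
    (hadd : Computable₂ fun x y : M => x + y) {n : α → ℕ} {f : α → ℕ → M} (hn : Computable n)
    (hf : Computable₂ f) : Computable fun a => ∑ i ∈ Finset.range (n a), f a i := by
  have key : Computable fun a => Nat.rec (motive := fun _ => M) 0 (fun y s => s + f a y) (n a) :=
    nat_rec (h := fun a p => p.2 + f a p.1) hn (const 0)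
      (hadd.comp (snd.comp snd) (hf.comp fst (fst.comp snd)))
  refine key.of_eq fun a => ?_
  induction n a with
  | zero => rfl
  | succ n ih => rw [Finset.sum_range_succ, ← ih]

theorem decide_eq [DecidableEq β] {f g : α → β} (hf : Computable f) (hg : Computable g) :
    Computable fun a => decide (f a = g a) :=
  (Primrec.eq (α := β)).decide.to_comp.comp hf hg

end Computable

theorem Primrec.nat_pow : Primrec₂ ((· ^ ·) : ℕ → ℕ → ℕ) :=
  Primrec₂.unpaired'.1 Nat.Primrec.pow

theorem primrec_blockLength : Primrec fun p : (ℕ × ℕ) × ℕ => blockLength p.1.1 p.1.2 p.2 := by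
  refine Primrec.nat_rec' (h := fun (p : (ℕ × ℕ) × ℕ) (q : ℕ × ℕ) =>
    q.2 * (p.1.2 ^ q.2 * p.1.1 + 1)) Primrec.snd (Primrec.const 1) ?_
  have hL : Primrec fun q : ((ℕ × ℕ) × ℕ) × ℕ × ℕ => q.2.2 := Primrec.snd.comp Primrec.snd
  have hp : Primrec fun q : ((ℕ × ℕ) × ℕ) × ℕ × ℕ => q.1.1 := Primrec.fst.comp Primrec.fst
  exact Primrec.nat_mul.comp hL (Primrec.succ.comp (Primrec.nat_mul.comp
    (Primrec.nat_pow.comp (Primrec.snd.comp hp) hL) (Primrec.fst.comp hp)))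

theorem computable_blockLength :
    Computable₂ fun n k : ℕ => blockLength n (2 * k) (n + 1) :=
  (primrec_blockLength.comp ((Primrec.fst.pair
    (Primrec.nat_mul.comp (Primrec.const 2) Primrec.snd)).pair
      (Primrec.succ.comp Primrec.fst))).to_comp

/-! ### Enumeration of words and evaluation by finite tables -/

section Words

variable {A : Type*}

/-- The words of length at most `n` with letters from a list. -/
def wordsUpTo (letters : List A) (n : ℕ) : List (List A) :=
  Nat.rec [[]] (fun _ ws => [] :: ws.flatMap fun w => letters.map fun a => a :: w) n

theorem mem_wordsUpTo {letters : List A} (h : ∀ a, a ∈ letters) (n : ℕ) (w : List A) :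
    w ∈ wordsUpTo letters n ↔ w.length ≤ n := by
  induction n generalizing w with
  | zero => simp [wordsUpTo]
  | succ n ih =>
    change w ∈ [] :: (wordsUpTo letters n).flatMap _ ↔ _
    cases w with
    | nil => simp
    | cons a w => simp [ih, h]

theorem primrec_wordsUpTo [Primcodable A] (letters : List A) : Primrec (wordsUpTo letters) := by
  refine Primrec.nat_rec₁ (f := fun _ ws => [] :: ws.flatMap fun w => letters.map fun a => a :: w)
    [[]] ?_
  refine Primrec.list_cons.comp (Primrec.const []) (Primrec.list_flatMap Primrec.snd ?_)
  exact Primrec.list_map (Primrec.const letters)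
    (Primrec.list_cons.comp Primrec.snd (Primrec.snd.comp Primrec.fst))

end Words

/-- Finite tables of coefficients. -/
abbrev CoeffTable (A K : Type*) := List (List A × K)

namespace CoeffTable

variable {A K : Type*} [Field K]

open Classical in
/-- The coefficient that a table gives to a word. -/
noncomputable def lookup (t : CoeffTable A K) : WordSeries A K := fun w =>
  -- The last matching entry wins, and absent words get 0.
  t.foldl (fun s q => bif decide (q.1 = w) then q.2 else s) 0

/-- The table of the values of `S` on a list of words. -/
def tabulate (ws : List (List A)) (S : WordSeries A K) : CoeffTable A K :=
  ws.map fun w => (w, S w)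

/-- A table represents a series on a list of words. -/
def Represents (ws : List (List A)) (t : CoeffTable A K) (S : WordSeries A K) : Prop :=
  ∀ w ∈ ws, t.lookup w = S w

theorem represents_tabulate (ws : List (List A)) (S : WordSeries A K) :
    Represents ws (tabulate ws S) S := by
  intro w hw
  induction ws using List.reverseRecOn with
  | nil => simp at hw
  | append_singleton ws v ih =>
    rw [tabulate, lookup, List.map_append, List.foldl_append]
    by_cases h : v = w
    · simp [h]
    · have hw : w ∈ ws := by
        rcases List.mem_append.1 hw with hw | hw
        · exact hw
        · exact absurd (List.mem_singleton.1 hw).symm h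
      simpa [h, lookup, tabulate] using ih hw

theorem Represents.tabulate {ws : List (List A)} {S T : WordSeries A K}
    (h : ∀ w ∈ ws, S w = T w) : Represents ws (tabulate ws S) T :=
  fun w hw => (represents_tabulate ws S w hw).trans (h w hw)

/-- The table of a power for the Cauchy product. -/
noncomputable def pow (ws : List (List A)) (t : CoeffTable A K) (k : ℕ) : CoeffTable A K :=
  Nat.rec (tabulate ws (WordSeries.const 1))
    (fun _ s => tabulate ws (WordSeries.cauchy t.lookup s.lookup)) k

/-- The table of a star. -/
noncomputable def star (ws : List (List A)) (t : CoeffTable A K) : CoeffTable A K :=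
  tabulate ws fun w => ∑ k ∈ Finset.range (w.length + 1), (pow ws t k).lookup w

section Represents

variable {n : ℕ} {ws : List (List A)}

/-- The list consists of all words up to a length, so it is closed under the prefixes and suffixes
that the product consults. -/
theorem Represents.cauchy (hws : ∀ w, w ∈ ws ↔ w.length ≤ n) {t s : CoeffTable A K}
    {S T : WordSeries A K} (ht : Represents ws t S) (hs : Represents ws s T) :
    Represents ws (CoeffTable.tabulate ws (WordSeries.cauchy t.lookup s.lookup))
      (WordSeries.cauchy S T) := by
  refine Represents.tabulate fun w hw => Finset.sum_congr rfl fun i _ => ?_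
  rw [hws] at hw
  rw [ht, hs]
  · rw [hws, List.length_drop]; omega
  · rw [hws, List.length_take]; omega

theorem Represents.pow (hws : ∀ w, w ∈ ws ↔ w.length ≤ n) {t : CoeffTable A K}
    {S : WordSeries A K} (ht : Represents ws t S) (k : ℕ) :
    Represents ws (pow ws t k) (WordSeries.cauchyPow S k) := by
  induction k with
  | zero => exact represents_tabulate ws _
  | succ k ih => exact ht.cauchy hws ih

theorem Represents.star (hws : ∀ w, w ∈ ws ↔ w.length ≤ n) {t : CoeffTable A K}
    {S : WordSeries A K} (ht : Represents ws t S) :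
    Represents ws (star ws t) (WordSeries.star S) :=
  Represents.tabulate fun w hw => Finset.sum_congr rfl fun k _ => ht.pow hws k w hw

end Represents

section Computable

variable [Primcodable A] [Primcodable K] {α : Type*} [Primcodable α]

open Computable

theorem computable_lookup {t : α → CoeffTable A K} {w : α → List A} (ht : Computable t)
    (hw : Computable w) : Computable fun a => (t a).lookup (w a) := by
  classical
  refine (list_foldl (h := fun a (p : K × List A × K) =>
    bif decide (p.2.1 = w a) then p.2.2 else p.1) ht (const 0) ?_).of_eq fun a => ?_
  · exact Computable.cond (decide_eq (fst.comp (snd.comp snd)) (hw.comp fst))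
      (snd.comp (snd.comp snd)) (fst.comp snd)
  · rw [lookup]

theorem computable_tabulate {K : Type*} [Primcodable K] {ws : α → List (List A)} {S : α → WordSeries A K}
    (hws : Computable ws) (hS : Computable₂ S) : Computable fun a => tabulate (ws a) (S a) :=
  list_map hws (Computable.snd.pair hS)

theorem computable_cauchy (hadd : Computable₂ fun x y : K => x + y)
    (hmul : Computable₂ fun x y : K => x * y) {S T : α → WordSeries A K}
    (hS : Computable₂ S) (hT : Computable₂ T) :
    Computable₂ fun a w => WordSeries.cauchy (S a) (T a) w := by
  refine sum_range hadd (f := fun (p : α × List A) i => S p.1 (p.2.take i) * T p.1 (p.2.drop i))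
    (Computable.succ.comp (list_length.comp snd)) ?_
  refine hmul.comp (hS.comp (fst.comp fst) ?_) (hT.comp (fst.comp fst) ?_)
  · exact Primrec.list_take.to_comp.comp snd (snd.comp fst)
  · exact Primrec.list_drop.to_comp.comp snd (snd.comp fst)

theorem computable_const {c : α → K} {w : α → List A} (hc : Computable c) (hw : Computable w) :
    Computable fun a => (WordSeries.const (c a) : WordSeries A K) (w a) := by
  classical
  refine (Computable.cond (decide_eq hw (Computable.const [])) hc (Computable.const 0)).of_eq
    fun a => ?_
  cases w a <;> rfl

theorem computable_letter {b : α → A} {w : α → List A} (hb : Computable b) (hw : Computable w) :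
    Computable fun a => (WordSeries.letter (b a) : WordSeries A K) (w a) := by
  classical
  refine (Computable.cond (decide_eq hw (list_cons.comp hb (Computable.const [])))
    (Computable.const 1) (Computable.const 0)).of_eq fun a => ?_
  by_cases h : w a = [b a] <;> simp [WordSeries.letter, h]

/-- The recursion runs over tables, which are finite data and can be coded, unlike series. -/
theorem computable_pow (hadd : Computable₂ fun x y : K => x + y)
    (hmul : Computable₂ fun x y : K => x * y) {ws : α → List (List A)} {t : α → CoeffTable A K}
    {k : α → ℕ} (hws : Computable ws) (ht : Computable t) (hk : Computable k) :
    Computable fun a => pow (ws a) (t a) (k a) := by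
  refine nat_rec (h := fun a (p : ℕ × CoeffTable A K) =>
    tabulate (ws a) (WordSeries.cauchy (t a).lookup p.2.lookup)) hk ?_ ?_
  · exact computable_tabulate hws (computable_const (Computable.const 1) snd)
  · refine computable_tabulate (α := α × ℕ × CoeffTable A K) (hws.comp fst)
      (computable_cauchy hadd hmul ?_ ?_)
    · exact computable_lookup (ht.comp (fst.comp fst)) snd
    · exact computable_lookup (snd.comp (snd.comp fst)) snd

theorem computable_star (hadd : Computable₂ fun x y : K => x + y)
    (hmul : Computable₂ fun x y : K => x * y) {ws : α → List (List A)} {t : α → CoeffTable A K}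
    (hws : Computable ws) (ht : Computable t) :
    Computable fun a => star (ws a) (t a) := by
  refine computable_tabulate hws ?_
  refine sum_range hadd (f := fun (p : α × List A) k => (pow (ws p.1) (t p.1) k).lookup p.2)
    (Computable.succ.comp (list_length.comp snd)) ?_
  exact computable_lookup (computable_pow hadd hmul (hws.comp (fst.comp fst))
    (ht.comp (fst.comp fst)) snd) (snd.comp fst)

end Computable

/-- One step of the evaluation of an expression in postfix notation by a stack machine whose
stack holds tables. -/
noncomputable def step (ws : List (List A)) (st : List (CoeffTable A K)) :
    RatExpr.Token A K → List (CoeffTable A K)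
  | Sum.inl (Sum.inl c) => tabulate ws (WordSeries.const c) :: st
  | Sum.inl (Sum.inr a) => tabulate ws (WordSeries.letter a) :: st
  | Sum.inr i =>
    -- The right operand is on top of the stack. On malformed strings `headI` yields an empty table,
    -- which keeps the machine total.
    bif decide (i = 0) then
      tabulate ws (fun w => st.tail.headI.lookup w + st.headI.lookup w) :: st.tail.tail
    else bif decide (i = 1) then
      tabulate ws (WordSeries.cauchy st.tail.headI.lookup st.headI.lookup) :: st.tail.tail
    else star ws st.headI :: st.tail

/-- Well-formedness plays no role: the truncated sum defining a star is evaluated literally. The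
arbitrary initial stack is what the induction needs for second operands. -/
theorem exists_foldl_step {n : ℕ} {ws : List (List A)} (hws : ∀ w, w ∈ ws ↔ w.length ≤ n)
    (e : RatExpr A K) (st : List (CoeffTable A K)) :
    ∃ t, Represents ws t e.eval ∧ e.postfixCode.foldl (step ws) st = t :: st := by
  induction e generalizing st with
  | const c => exact ⟨_, represents_tabulate ws _, rfl⟩
  | letter a => exact ⟨_, represents_tabulate ws _, rfl⟩
  | add e f ihe ihf =>
    obtain ⟨t, ht, het⟩ := ihe st
    obtain ⟨s, hs, hfs⟩ := ihf (t :: st)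
    refine ⟨_, ?_, by
      rw [RatExpr.postfixCode, List.foldl_append, List.foldl_append, het, hfs]; rfl⟩
    refine Represents.tabulate fun w hw => ?_
    change t.lookup w + s.lookup w = e.eval w + f.eval w
    rw [ht w hw, hs w hw]
  | mul e f ihe ihf =>
    obtain ⟨t, ht, het⟩ := ihe st
    obtain ⟨s, hs, hfs⟩ := ihf (t :: st)
    exact ⟨_, ht.cauchy hws hs, by
      rw [RatExpr.postfixCode, List.foldl_append, List.foldl_append, het, hfs]; rfl⟩
  | star e ih =>
    obtain ⟨t, ht, het⟩ := ih st
    exact ⟨_, ht.star hws, by rw [RatExpr.postfixCode, List.foldl_append, het]; rfl⟩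

theorem computable_step [Primcodable A] [Primcodable K] {α : Type*} [Primcodable α]
    (hadd : Computable₂ fun x y : K => x + y) (hmul : Computable₂ fun x y : K => x * y)
    {ws : α → List (List A)} {st : α → List (CoeffTable A K)} {tok : α → RatExpr.Token A K}
    (hws : Computable ws) (hst : Computable st) (htok : Computable tok) :
    Computable fun a => step (ws a) (st a) (tok a) := by
  have h1 : Computable₂ fun a (c : K) =>
      tabulate (ws a) (WordSeries.const c : WordSeries A K) :: st a :=
    Computable.list_cons.comp (computable_tabulate (hws.comp .fst)
      (computable_const (Computable.snd.comp .fst) .snd)) (hst.comp .fst)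
  have h2 : Computable₂ fun a (b : A) =>
      tabulate (ws a) (WordSeries.letter b : WordSeries A K) :: st a :=
    Computable.list_cons.comp (computable_tabulate (hws.comp .fst)
      (computable_letter (Computable.snd.comp .fst) .snd)) (hst.comp .fst)
  have h3 : Computable fun a => tabulate (ws a) (fun w =>
      (st a).tail.headI.lookup w + (st a).headI.lookup w) :: (st a).tail.tail :=
    Computable.list_cons.comp (computable_tabulate hws (hadd.comp
      (computable_lookup (Computable.list_headI (Computable.list_tail (hst.comp .fst))) .snd)
      (computable_lookup (Computable.list_headI (hst.comp .fst)) .snd))) (Computable.list_tail (Computable.list_tail hst))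
  have h4 : Computable fun a => tabulate (ws a) (WordSeries.cauchy
      (st a).tail.headI.lookup (st a).headI.lookup) :: (st a).tail.tail :=
    Computable.list_cons.comp (computable_tabulate hws (computable_cauchy hadd hmul
      (computable_lookup (Computable.list_headI (Computable.list_tail (hst.comp .fst))) .snd)
      (computable_lookup (Computable.list_headI (hst.comp .fst)) .snd))) (Computable.list_tail (Computable.list_tail hst))
  have h5 : Computable fun a => star (ws a) (st a).headI :: (st a).tail :=
    Computable.list_cons.comp (computable_star hadd hmul hws (Computable.list_headI hst)) (Computable.list_tail hst)
  have h6 : Computable₂ fun a (i : Fin 3) => step (ws a) (st a) (Sum.inr i) :=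
    Computable.cond (Computable.decide_eq .snd (.const 0)) (h3.comp .fst)
      (Computable.cond (Computable.decide_eq .snd (.const 1)) (h4.comp .fst) (h5.comp .fst))
  have h7 : Computable₂ fun a (x : K ⊕ A) => step (ws a) (st a) (Sum.inl x) :=
    (Computable.sumCasesOn .snd (h1.comp (Computable.fst.comp .fst) .snd).to₂
      (h2.comp (Computable.fst.comp .fst) .snd).to₂).of_eq fun p => by
        rcases p with ⟨a, c | b⟩ <;> rfl
  refine (Computable.sumCasesOn htok h7 h6).of_eq fun a => ?_
  cases tok a <;> rfl

theorem computable_foldl_step [Primcodable A] [Primcodable K] {α : Type*} [Primcodable α]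
    (hadd : Computable₂ fun x y : K => x + y) (hmul : Computable₂ fun x y : K => x * y)
    {ws : α → List (List A)} {code : α → List (RatExpr.Token A K)}
    (hws : Computable ws) (hcode : Computable code) :
    Computable fun a => (code a).foldl (step (ws a)) [] :=
  Computable.list_foldl
    (h := fun a (p : List (CoeffTable A K) × RatExpr.Token A K) => step (ws a) p.1 p.2)
    hcode (.const []) (computable_step hadd hmul (hws.comp .fst) (Computable.fst.comp .snd)
      (Computable.snd.comp .snd))

end CoeffTable

/-! ### Search for the minimum of the support -/

section MinSupport

variable {A : Type*}

open Classical in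
/-- The first smallest word, for the comparison `lt`, at which a series does not vanish, among the
words of a list. -/
noncomputable def minSupport {K : Type*} [Field K] (lt : List A × List A → Bool)
    (S : WordSeries A K) (ws : List (List A)) : Option (List A) :=
  ws.foldl (fun acc w => bif decide (S w = 0) then acc else
    Option.casesOn acc (some w) fun v => bif lt (w, v) then some w else some v) none

theorem computable_minSupport [Primcodable A] {K : Type*} [Field K] [Primcodable K] {α : Type*}
    [Primcodable α] {lt : List A × List A → Bool} (hlt : Computable lt)
    {S : α → WordSeries A K} {ws : α → List (List A)} (hS : Computable₂ S)
    (hws : Computable ws) : Computable fun a => minSupport lt (S a) (ws a) := by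
  classical
  refine (Computable.list_foldl (h := fun a (p : Option (List A) × List A) =>
    bif decide (S a p.2 = 0) then p.1 else
      Option.casesOn (motive := fun _ => Option (List A)) p.1 (some p.2)
        fun v => bif lt (p.2, v) then some p.2 else some v) hws (.const none) ?_).of_eq fun a => ?_
  · refine Computable.cond (Computable.decide_eq
      (hS.comp .fst (Computable.snd.comp .snd)) (.const 0)) (Computable.fst.comp .snd)
      (Computable.option_casesOn (Computable.fst.comp .snd)
        (Computable.option_some.comp (Computable.snd.comp .snd)) ?_)
    have h1 : Computable fun q : (α × Option (List A) × List A) × List A => q.1.2.2 :=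
      Computable.snd.comp (Computable.snd.comp .fst)
    exact Computable.cond (hlt.comp (h1.pair .snd)) (Computable.option_some.comp h1)
      (Computable.option_some.comp .snd)
  · rw [minSupport]

theorem minSupport_eq_none {K : Type*} [Field K] {lt : List A × List A → Bool}
    {S : WordSeries A K} (hS : S.supp = ∅) (ws : List (List A)) : minSupport lt S ws = none := by
  classical
  have h : ∀ w, S w = 0 := fun w => by
    by_contra hw
    exact (hS ▸ (show w ∈ S.supp from hw) : w ∈ (∅ : Set _))
  induction ws using List.reverseRecOn with
  | nil => rfl
  | append_singleton ws w ih =>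
    rw [minSupport, List.foldl_append, ← minSupport, ih]
    simp [h]

theorem mem_supp_of_minSupport_eq_some {K : Type*} [Field K] {lt : List A × List A → Bool}
    {S : WordSeries A K} (ws : List (List A)) {u : List A} (hu : minSupport lt S ws = some u) :
    u ∈ S.supp := by
  classical
  induction ws using List.reverseRecOn generalizing u with
  | nil => simp [minSupport] at hu
  | append_singleton ws v ih =>
    rw [minSupport, List.foldl_append, ← minSupport, List.foldl_cons, List.foldl_nil] at hu
    by_cases hv : S v = 0
    · simp only [hv, decide_true, cond_true] at hu
      exact ih hu
    · simp only [hv, decide_false, cond_false] at hu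
      rcases hm : minSupport lt S ws with _ | x
      · rw [hm, Option.some_inj] at hu
        exact hu ▸ hv
      · rw [hm] at hu
        rcases hb : lt (v, x) with _ | _
        · simp only [hb, cond_false, Option.some_inj] at hu
          exact hu ▸ ih hm
        · simp only [hb, cond_true, Option.some_inj] at hu
          exact hu ▸ hv

/-- The search returns a word of the support that is minimal among the listed ones. -/
theorem minSupport_spec {K β : Type*} [Field K] [LinearOrder β] (f : List A → β)
    {lt : List A × List A → Bool} (hlt : ∀ v w, lt (v, w) = true ↔ f v < f w)
    (S : WordSeries A K) (ws : List (List A)) {w₀ : List A} (h₀ : w₀ ∈ S.supp) (hw₀ : w₀ ∈ ws) :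
    ∃ w ∈ S.supp, minSupport lt S ws = some w ∧ f w ≤ f w₀ := by
  classical
  induction ws using List.reverseRecOn generalizing w₀ with
  | nil => simp at hw₀
  | append_singleton ws v ih =>
    rw [minSupport, List.foldl_append, ← minSupport, List.foldl_cons, List.foldl_nil]
    by_cases hv : S v = 0
    · have hmem : w₀ ∈ ws := by
        rcases List.mem_append.1 hw₀ with h | h
        · exact h
        · rw [List.mem_singleton.1 h] at h₀
          exact absurd hv h₀
      simpa [hv] using ih h₀ hmem
    · have hsupp : v ∈ S.supp := hv
      simp only [hv, decide_false, cond_false]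
      rcases hm : minSupport lt S ws with _ | u
      · refine ⟨v, hsupp, rfl, ?_⟩
        rcases List.mem_append.1 hw₀ with h | h
        · obtain ⟨w, _, hw, _⟩ := ih h₀ h
          rw [hm] at hw
          exact absurd hw (by simp)
        · rw [List.mem_singleton.1 h]
      · have hu : ∀ w₁ ∈ S.supp, w₁ ∈ ws → f u ≤ f w₁ := by
          intro w₁ h₁ hw₁
          obtain ⟨w, _, hw', hle⟩ := ih h₁ hw₁
          rw [hm, Option.some_inj] at hw'
          exact hw' ▸ hle
        have hor : w₀ ∈ ws ∨ w₀ = v := by simpa using hw₀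
        rcases hb : lt (v, u) with _ | _
        · have hle : f u ≤ f v := not_lt.1 fun h => by
            rw [(hlt v u).2 h] at hb
            exact absurd hb (by simp)
          refine ⟨u, mem_supp_of_minSupport_eq_some ws hm, by simp [hb], ?_⟩
          rcases hor with h | rfl
          · exact hu w₀ h₀ h
          · exact hle
        · refine ⟨v, hsupp, by simp [hb], ?_⟩
          rcases hor with h | rfl
          · exact ((hlt v u).1 hb).le.trans (hu w₀ h₀ h)
          · exact le_rfl

end MinSupport

/-- A length bound for the words among which the minimum of the support of the series denoted by
an expression with `l` symbols is searched. -/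
def searchBound (k l : ℕ) : ℕ :=
  blockLength (2 * l) (2 * k) (2 * l + 1)

/-- The search for the minimum of the support, for an expression in postfix notation. -/
noncomputable def minSupportOfCode {A K : Type*} [Field K] (letters : List A) (k : ℕ)
    (lt : List A × List A → Bool) (code : List (RatExpr.Token A K)) : Option (List A) :=
  minSupport lt
    (code.foldl (CoeffTable.step (wordsUpTo letters (searchBound k code.length))) []).headI.lookup
    (wordsUpTo letters (searchBound k code.length))

theorem computable_minSupportOfCode {A K : Type*} [Field K] [Primcodable A] [Primcodable K]
    (hadd : Computable₂ fun x y : K => x + y) (hmul : Computable₂ fun x y : K => x * y)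
    (letters : List A) (k : ℕ) {lt : List A × List A → Bool} (hlt : Computable lt) :
    Computable (minSupportOfCode (K := K) letters k lt) := by
  have hlen : Computable fun c : List (RatExpr.Token A K) => 2 * c.length :=
    (Primrec.nat_mul.comp (Primrec.const 2) Primrec.list_length).to_comp
  -- `searchBound` is the deletion bound at rank `2 * l`, the estimate of `RatExpr.hankelRankLE`.
  have hbound : Computable fun c : List (RatExpr.Token A K) => searchBound k c.length :=
    computable_blockLength.comp hlen (Computable.const k)
  have hws := (primrec_wordsUpTo letters).to_comp.comp hbound
  have hfold := Computable.list_headI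
    (CoeffTable.computable_foldl_step hadd hmul hws Computable.id)
  exact computable_minSupport hlt (CoeffTable.computable_lookup (hfold.comp .fst) .snd) hws

/-- The search reads values only on the list, so a table can replace the series. -/
theorem minSupport_congr {A K : Type*} [Field K] {lt : List A × List A → Bool}
    {S T : WordSeries A K} {ws : List (List A)} (h : ∀ w ∈ ws, S w = T w) :
    minSupport lt S ws = minSupport lt T ws :=
  List.foldl_ext _ _ _ fun acc w hw => by rw [h w hw]

theorem minSupportOfCode_postfixCode {A K : Type*} [Field K] {letters : List A}
    (hl : ∀ a, a ∈ letters) (k : ℕ) (lt : List A × List A → Bool) (e : RatExpr A K) :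
    minSupportOfCode letters k lt e.postfixCode =
      minSupport lt e.eval (wordsUpTo letters (searchBound k e.postfixCode.length)) := by
  obtain ⟨t, ht, het⟩ := CoeffTable.exists_foldl_step (mem_wordsUpTo hl _) e []
  rw [minSupportOfCode, het]
  exact minSupport_congr ht

/-! ### Assembly of the bound and the algorithm -/

theorem mainTheorem7 :
    -- a computable bound beyond which words of the support have smaller subwords in the support
    (∃ N : ℕ → ℕ → ℕ, Computable₂ N ∧
      ∀ (K : Type*) [Field K] (X : Type*) [Finite X]
        [LinearOrder (FreeGroup X)] [MulLeftMono (FreeGroup X)] [MulRightMono (FreeGroup X)]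
        (S : WordSeries (X × Bool) K), S.IsRational → S.HasReducedWellOrderedSupport →
        ∀ w ∈ S.supp, N S.hankelRank (Nat.card X) ≤ w.length →
          ∃ v ∈ S.supp, v.Sublist w ∧ FreeGroup.mk v < FreeGroup.mk w) ∧
    -- for a computable field and a computable order, the minimum is computed by an algorithm
    (∀ (K : Type*) [Field K] [Primcodable K] (X : Type*) [Finite X] [Primcodable X]
      [LinearOrder (FreeGroup X)] [MulLeftMono (FreeGroup X)] [MulRightMono (FreeGroup X)],
      Computable₂ (fun a b : K => a + b) → Computable₂ (fun a b : K => a * b) →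
      ComputablePred (fun p : List (X × Bool) × List (X × Bool) =>
        FreeGroup.mk p.1 < FreeGroup.mk p.2) →
      ∃ f : List (RatExpr.Token (X × Bool) K) → Option (List (X × Bool)), Computable f ∧
        ∀ e : RatExpr (X × Bool) K, e.WellFormed → e.eval.HasReducedWellOrderedSupport →
          (e.eval.supp = ∅ → f e.postfixCode = none) ∧
          (e.eval.supp.Nonempty →
            ∃ w, f e.postfixCode = some w ∧ e.eval.IsMinSupp w)) := by
  constructor
  · refine ⟨fun n k => blockLength n (2 * k) (n + 1), computable_blockLength, ?_⟩
    intro K _ X _ _ _ _ S hrat hS w hw hlen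
    obtain ⟨e, he, rfl⟩ := hrat
    have := (e.hankelRankLE he).1
    exact WordSeries.exists_smaller_sublist hS le_rfl hw hlen
  · rintro K _ _ X _ _ _ _ _ hadd hmul ⟨hdec, hlt⟩
    have := Fintype.ofFinite X
    have hl : ∀ a : X × Bool, a ∈ (Finset.univ : Finset (X × Bool)).toList := by simp
    refine ⟨_, computable_minSupportOfCode hadd hmul Finset.univ.toList (Nat.card X) hlt, ?_⟩
    intro e he hS
    rw [minSupportOfCode_postfixCode hl]
    refine ⟨fun h => minSupport_eq_none h _, fun hne => ?_⟩
    have hrank := e.hankelRankLE he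
    have := hrank.1
    obtain ⟨w₀, h₀, hw₀⟩ := hS.2.min_mem (hne.image _)
    have hmin : ∀ v ∈ e.eval.supp, FreeGroup.mk w₀ ≤ FreeGroup.mk v := fun v hv => by
      rw [hw₀]
      exact hS.2.min_le _ ⟨v, hv, rfl⟩
    obtain ⟨w, hw, hsome, hle⟩ := minSupport_spec FreeGroup.mk
      (lt := fun p => decide (FreeGroup.mk p.1 < FreeGroup.mk p.2)) (fun v w => by simp) e.eval
      (wordsUpTo Finset.univ.toList (searchBound (Nat.card X) e.postfixCode.length)) h₀ (by
        -- The true minimum is among the words searched: were it too long, deletion would give a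
        -- smaller word of the support.
        rw [mem_wordsUpTo hl]
        by_contra! hlong
        obtain ⟨v, hv, _, hlt⟩ := WordSeries.exists_smaller_sublist hS hrank.2 h₀ hlong.le
        exact not_lt.2 (hmin v hv) hlt)
    exact ⟨w, hsome, hw, fun v hv => hle.trans (hmin v hv)⟩
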